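/- **Games.** A $b$-bounded concurrent game has a finite state set $V$ with initial state $v_0$, finitely many agents with finite action sets $A_i$, a set $P(v)$ of at most $b$ active agents for each state $v$, a transition function assigning to $v$ and a tuple of actions of the agents in $P(v)$ a distribution over $V$, goals $G_i\subseteq V$, and a horizon $F\ge 1$. A play visits exactly $F$ states, starting with $v_0$ (so there are $F-1$ action choices and transitions). A strategy of Agent $i$ is any function from nonempty words over $V$ to distributions over $A_i$. The payoff of Agent $i$ under a profile is the probability that the play visits $G_i$. A profile is a Nash equilibrium if no agent can strictly increase its payoff by changing its own strategy. A transducer with finite state set $S$, initial state $s_0$, transition function $\gamma:S\times V\to S$ and output function $O$ represents the strategy $v_0\cdots v_m\mapsto O(s_m,v_m)$, where $s_{j+1}=\gamma(s_j,v_j)$. **Machines.** Let $M=\langle R,\Gamma,r_0,\Delta,\kappa\rangle$ be an alternating Turing machine with finite state set $R$ and finite alphabet $\Gamma\ni\emptyset$ (blank), $\Delta:R\times\Gamma\to\mathcal P(R\times\Gamma\times\{\to,\leftarrow\})$ with $|\Delta(r,g)|\le 2$, and $\kappa$ labelling each state accepting, rejecting, existential ($\vee$), universal ($\wedge$) or deterministic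 ($-$). For deterministic $r$ the set $\Delta(r,g)$ has one element; for existential or universal $r$ it has one or two, named the $\alpha$- and $\beta$-successor (equal if there is only one). Accepting and rejecting states halt. Let $n\ge 1$. $M$ *accepts the empty tape using at most $n$ cells* if there is a finite accepting computation tree whose root is the initial ID ($n$ blank cells, head on cell $1$, state $r_0$): leaves are IDs with accepting state, an existential or deterministic ID has one successor ID as child, and a universal ID has all its successors as children. A transition that moves the head off the $n$ cells rejects; in particular none may be available at a universal ID of the tree. **The game $\mathbb G$.** It is $1$-bounded with agents $1,\dots,n+1$. Its states are $\langle i,\emptyset\rangle,\langle i,\vee\rangle$ ($V_1$), $\langle i,g,d,r\rangle$ ($V_2$), $\langle i,\alpha\rangle,\langle i,\beta\rangle$ ($V_3$) for $i\in[n]$, $g\in\Gamma$, $d\in\{\to,\leftarrow\}$, $r\in R$, and $\mathsf{start}$ (initial), $\mathsf{base}$, $\mathsf{goal}$, $\mathsf{sink}$. For $i\le n$ put $A_i=V_2\cup\{*,X\}$ and $G_i=V$; put $A_{n+1}=\{\alpha,\beta\}$ and $G_{n+1}=\{\mathsf{goal}\}$. At $\langle i,\emptyset\rangle,\langle i,\alpha\rangle,\langle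 i,\beta\rangle$ Agent $i$ is active: an action in $V_2$ leads to that state, $*$ to $\mathsf{goal}$, $X$ to $\mathsf{sink}$. At $\langle i,\vee\rangle$ Agent $n+1$ is active, and $c\in\{\alpha,\beta\}$ leads to $\langle i,c\rangle$. At $\mathsf{start}$ Agent $n+1$ is active: $\alpha$ leads to $\mathsf{base}$, and $\beta$ leads to $\langle 1,\vee\rangle$ if $r_0$ is existential and to $\langle 1,\emptyset\rangle$ otherwise. At all other states nobody is active: $\langle i,g,d,r\rangle$ leads to $\mathsf{sink}$ if the cell $i'$ reached from $i$ in direction $d$ is not in $[n]$, otherwise to $\langle i',\vee\rangle$ if $r$ is existential and to $\langle i',\emptyset\rangle$ if not; $\mathsf{base}$ stays with probability $0.25$ and leads to $\mathsf{goal}$ with probability $0.75$; $\mathsf{goal}$ and $\mathsf{sink}$ are absorbing. The horizon is $F=3\,\bigl(|\Gamma|\,(|R|+1)\bigr)^n+1$. All transition probabilities have three binary digits (one before the point). **The profile $\pi$.** $\pi_{n+1}$ is the one-state transducer that always plays $\alpha$. For $i\le n$, $\pi_i$ has states $\langle g,r,s\rangle\in\Gamma\times(R\cup\{\emptyset\})\times\{\alpha,\beta,\emptyset\}$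 and starts in $\langle\emptyset,r_0,\emptyset\rangle$ if $i=1$, in $\langle\emptyset,\emptyset,\emptyset\rangle$ otherwise. On reading $\langle j,g',d,r'\rangle\in V_2$ it replaces $g$ by $g'$ if $j=i$, replaces $r$ by $r'$ if moving from cell $j$ in direction $d$ leads to cell $i$ and by $\emptyset$ otherwise, and resets $s$ to $\emptyset$; on reading $\langle i,c\rangle\in V_3$ it sets $s$ to $c$; other inputs leave the state unchanged. The output at transducer state $q$ and game state $v$ is determined by $\langle g,r,s\rangle=\gamma^i(q,v)$: it is $*$ if $r$ is accepting, $X$ if $r$ is rejecting, the action $\langle i,g',d',r'\rangle$ given by the unique transition $(r',g',d')\in\Delta(r,g)$ if $r$ is deterministic, each of the actions given by the $\alpha$- and the $\beta$-successor with probability $1/2$ if $r$ is universal, and the action given by the $s$-successor if $r$ is existential and $s\ne\emptyset$. In the remaining cases ($r=\emptyset$, or $r$ existential and $s=\emptyset$) it is an arbitrary fixed action, which may depend on $i$ and $\langle g,r,s\rangle$. These probabilities also have three binary digits. **Theorem.** For every such $M$, every naming of successors, every $n\ge1$ and every choice of the arbitrary actions: 1. $\pi=\langle\pi_1,\dots,\pi_{n+1}\rangle$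 is a Nash equilibrium in $\mathbb G$ if and only if $M$ does not accept the empty tape using at most $n$ cells. 2. The payoff of Agent $n+1$ under $\pi$ is $1-0.25^{F-2}$. 3. If $M$ accepts the empty tape using at most $n$ cells, Agent $n+1$ has a strategy that, against $\pi_1,\dots,\pi_n$, has payoff $1$. 4. If $M$ does not, every strategy of Agent $n+1$ that plays $\beta$ at $\mathsf{start}$ with probability $1$ has, against $\pi_1,\dots,\pi_n$, payoff at most $1-0.5^{F-1}$; and $1-0.5^{F-1}<1-0.25^{F-2}$. -/

import Mathlib

/-! ### Finite distributions -/

/-- Probability distributions over a finite set. -/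
abbrev FinDist (X : Type) [Fintype X] : Type := stdSimplex ℝ X

/-- `x` can be written in binary with exactly `L` digits, one of them before the point
(so that, for example, `0`, `0.01`, `0.10`, `0.11`, `1.00` all have three digits). -/
def HasBits (L : ℕ) (x : ℝ) : Prop := ∃ m : ℕ, m < 2 ^ L ∧ x = (m : ℝ) / 2 ^ (L - 1)

/-- All probabilities of a distribution have `L` digits. -/
def FinDistHasBits {X : Type} [Fintype X] (L : ℕ) (p : FinDist X) : Prop := ∀ x, HasBits L (p x)

/-- The point mass at `x`. -/
noncomputable abbrev FinDist.point {X : Type} [Fintype X] [DecidableEq X] (x : X) : FinDist X :=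
  stdSimplex.vertex x

/-- The distribution giving weight `k / 4` to `x` and `1 - k / 4` to `y`
(a point mass if `x = y`). -/
noncomputable def FinDist.quarters {X : Type} [Fintype X] [DecidableEq X]
    (k : ℕ) (hk : k ≤ 4) (x y : X) : FinDist X :=
  ⟨fun z => (k : ℝ) / 4 * (Pi.single x 1 : X → ℝ) z
      + (1 - (k : ℝ) / 4) * (Pi.single y 1 : X → ℝ) z, by
    have hk' : (k : ℝ) ≤ 4 := by exact_mod_cast hk
    refine ⟨fun z => ?_, ?_⟩
    · have h1 : 0 ≤ (Pi.single x 1 : X → ℝ) z := by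
        rw [Pi.single_apply]; split_ifs <;> norm_num
      have h2 : 0 ≤ (Pi.single y 1 : X → ℝ) z := by
        rw [Pi.single_apply]; split_ifs <;> norm_num
      have h3 : 0 ≤ 1 - (k : ℝ) / 4 := by linarith
      positivity
    · rw [Finset.sum_add_distrib, ← Finset.mul_sum, ← Finset.mul_sum]
      simp⟩

theorem FinDist.point_hasBits {X : Type} [Fintype X] [DecidableEq X] (x : X) :
    FinDistHasBits 3 (FinDist.point x) := by
  intro z
  change HasBits 3 ((Pi.single x 1 : X → ℝ) z)
  rw [Pi.single_apply]
  split_ifs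
  · exact ⟨4, by norm_num, by norm_num⟩
  · exact ⟨0, by norm_num, by norm_num⟩

theorem FinDist.quarters_hasBits {X : Type} [Fintype X] [DecidableEq X]
    (k : ℕ) (hk : k ≤ 4) (x y : X) : FinDistHasBits 3 (FinDist.quarters k hk x y) := by
  intro z
  change HasBits 3 ((k : ℝ) / 4 * (Pi.single x 1 : X → ℝ) z
      + (1 - (k : ℝ) / 4) * (Pi.single y 1 : X → ℝ) z)
  rw [Pi.single_apply, Pi.single_apply]
  split_ifs
  · exact ⟨4, by norm_num, by norm_num⟩
  · exact ⟨k, by omega, by norm_num⟩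
  · refine ⟨4 - k, by omega, ?_⟩
    rw [Nat.cast_sub hk]
    norm_num
    ring
  · exact ⟨0, by norm_num, by norm_num⟩

/-! ### Concurrent games, strategies, transducers, Nash equilibria -/

/-- A `b`-bounded concurrent game system with finite state set `V`, finite set of agents `Ω`
and finite action sets `A i`. The transition function maps a state `v` and a tuple of actions
of the agents that are active at `v` to a distribution over `V`. -/
structure ConcurrentGame (b : ℕ) (V Ω : Type) [Fintype V] (A : Ω → Type) where
  one_le_b : 1 ≤ b
  /-- the initial state -/
  v₀ : V
  /-- the playing function: the agents that are active at a state -/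
  P : V → Finset Ω
  bounded : ∀ v, (P v).card ≤ b
  /-- the transition function -/
  δ : (v : V) → ((i : P v) → A i) → FinDist V
  /-- the number of digits of the transition probabilities -/
  L : ℕ
  δ_bits : ∀ v θ, FinDistHasBits L (δ v θ)
  /-- the reachability goals -/
  G : Ω → Set V
  /-- the time horizon: a play visits exactly `F` states, the initial one included -/
  F : ℕ
  one_le_F : 1 ≤ F

/-- Strategies `V⁺ → 𝔻(A)`; a word of `V⁺` is a tuple of `m + 1` letters for some `m`. -/
abbrev Strategy (V A : Type) [Fintype A] : Type := (m : ℕ) → (Fin (m + 1) → V) → FinDist A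

/-- A probabilistic transducer: finite state set, deterministic transition function,
probabilistic output function, whose probabilities have `L` digits. -/
structure Transducer (V A : Type) [Fintype A] (L : ℕ) where
  S : Type
  finite : Finite S
  s₀ : S
  γ : S → V → S
  O : S → V → FinDist A
  O_bits : ∀ s v, FinDistHasBits L (O s v)

/-- The strategy represented by a transducer: at a history `v₀ … vₘ` the transducer, which has
made its transitions on `v₀, …, vₘ₋₁`, outputs `O(s, vₘ)` in its current state `s`. -/
def Transducer.strategy {V A : Type} [Fintype A] {L : ℕ} (T : Transducer V A L) :
    Strategy V A :=
  fun m w => T.O ((List.ofFn (fun j : Fin m => w j.castSucc)).foldl T.γ T.s₀) (w (Fin.last m))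

namespace ConcurrentGame

section

variable {b : ℕ} {V Ω : Type} [Fintype V] [DecidableEq V] [Fintype Ω] [DecidableEq Ω]
  {A : Ω → Type} [∀ i, Fintype (A i)] [∀ i, DecidableEq (A i)]

/-- A play: `F` states, and at each of them but the last the actions of the active agents. -/
abbrev Play (𝔾 : ConcurrentGame b V Ω A) : Type :=
  Σ s : Fin (𝔾.F - 1 + 1) → V, (k : Fin (𝔾.F - 1)) → (i : 𝔾.P (s k.castSucc)) → A i

/-- The history `s₀ … s_k`, the first `k + 1` states of a play. -/
def prefixUpTo {N : ℕ} (s : Fin (N + 1) → V) (k : Fin N) : Fin (k.val + 1) → V :=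
  fun j => s (Fin.castLE (by omega) j)

/-- The probability that a play is sampled when the agents follow the profile `π`. -/
noncomputable def playProb (𝔾 : ConcurrentGame b V Ω A) (π : (i : Ω) → Strategy V (A i))
    (t : 𝔾.Play) : ℝ :=
  (if t.1 0 = 𝔾.v₀ then 1 else 0) *
    ∏ k : Fin (𝔾.F - 1),
      ((∏ i : 𝔾.P (t.1 k.castSucc), π i k.val (prefixUpTo t.1 k) (t.2 k i)) *
        𝔾.δ (t.1 k.castSucc) (t.2 k) (t.1 k.succ))

open Classical in
/-- The payoff of Agent `i` from a play: `1` if the play visits the goal `G i`, otherwise `0`. -/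
noncomputable def playPayoff (𝔾 : ConcurrentGame b V Ω A) (t : 𝔾.Play) (i : Ω) : ℝ :=
  if ∃ k, t.1 k ∈ 𝔾.G i then 1 else 0

/-- The payoff of Agent `i` under a strategy profile. -/
noncomputable def payoff (𝔾 : ConcurrentGame b V Ω A) (π : (i : Ω) → Strategy V (A i))
    (i : Ω) : ℝ :=
  ∑ t : 𝔾.Play, 𝔾.playProb π t * 𝔾.playPayoff t i

/-- `π` is a Nash equilibrium: no agent has a profitable unilateral deviation. -/
def IsNash (𝔾 : ConcurrentGame b V Ω A) (π : (i : Ω) → Strategy V (A i)) : Prop :=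
  ∀ (i : Ω) (σ : Strategy V (A i)), 𝔾.payoff (Function.update π i σ) i ≤ 𝔾.payoff π i

end

end ConcurrentGame

/-! ### Space-bounded alternating Turing machines -/

inductive Dir where
  | left
  | right
deriving DecidableEq

instance : Fintype Dir := ⟨{.left, .right}, by intro d; cases d <;> decide⟩

/-- The types of machine states: accepting, rejecting, existential (`∨`), universal (`∧`),
deterministic (`-`). -/
inductive Kind where
  | accept
  | reject
  | exist
  | univ
  | det
deriving DecidableEq

/-- An alternating Turing machine with state set `R` and alphabet `Γ`. A state-character pair has
at most two successors; it has exactly one if the state is deterministic, and at least one if the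
state is existential or universal (the accepting and the rejecting states halt). -/
structure ATM (R Γ : Type) where
  r₀ : R
  blank : Γ
  Δ : R → Γ → Set (R × Γ × Dir)
  κ : R → Kind
  card_le_two : ∀ r g, (Δ r g).encard ≤ 2
  det_unique : ∀ r g, κ r = .det → ∃! t, t ∈ Δ r g
  branch_nonempty : ∀ r g, κ r = .exist ∨ κ r = .univ → (Δ r g).Nonempty

/-- The names of the two successors, which are also the actions of Agent `n + 1`. -/
inductive Branch where
  | α
  | β
deriving DecidableEq

instance : Fintype Branch := ⟨{.α, .β}, by intro c; cases c <;> decide⟩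

/-- The cell reached from cell `i` in direction `d`, if it is one of the `n` cells. -/
def moveHead {n : ℕ} (i : Fin n) : Dir → Option (Fin n)
  | .right => if h : i.val + 1 < n then some ⟨i.val + 1, h⟩ else none
  | .left => if 0 < i.val then some ⟨i.val - 1, by omega⟩ else none

/-- An ID of a machine with `n` cells: the contents of the cells, the cell under the head and
the state. -/
structure MachineID (n : ℕ) (R Γ : Type) where
  tape : Fin n → Γ
  head : Fin n
  state : R

namespace ATM

variable {R Γ : Type}

/-- A choice of which successor is called `α` and which is called `β`
(they coincide if there is only one successor). -/
structure SuccessorNaming (M : ATM R Γ) where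
  succ : Branch → R → Γ → R × Γ × Dir
  spec : ∀ r g, M.κ r = .det ∨ M.κ r = .exist ∨ M.κ r = .univ →
    M.Δ r g = {succ .α r g, succ .β r g}

/-- The initial ID: all cells are empty, the head is at the leftmost cell in state `r₀`. -/
def initID (M : ATM R Γ) (n : ℕ) [NeZero n] : MachineID n R Γ :=
  ⟨fun _ => M.blank, 0, M.r₀⟩

/-- The ID after a transition; `none` if the head would leave the `n` cells. -/
def applyTrans {n : ℕ} (c : MachineID n R Γ) (t : R × Γ × Dir) : Option (MachineID n R Γ) :=
  (moveHead c.head t.2.2).map fun i =>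
    ⟨Function.update c.tape c.head t.2.1, i, t.1⟩

/-- The transitions available at an ID. -/
def transAt (M : ATM R Γ) {n : ℕ} (c : MachineID n R Γ) : Set (R × Γ × Dir) :=
  M.Δ c.state (c.tape c.head)

/-- The (finite) accepting computation trees of `M` on `n` cells with a given ID at the root:
a leaf is an accepting ID, an existential or deterministic ID has one child, a successor ID,
and a universal ID has all its successors as children, none of which may use a further cell. -/
inductive AcceptingTree (M : ATM R Γ) (n : ℕ) : MachineID n R Γ → Type
  | leaf (c : MachineID n R Γ) (hc : M.κ c.state = .accept) : AcceptingTree M n c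
  | choose (c : MachineID n R Γ) (hc : M.κ c.state = .exist ∨ M.κ c.state = .det)
      (t : R × Γ × Dir) (ht : t ∈ M.transAt c) (c' : MachineID n R Γ)
      (hc' : applyTrans c t = some c') (child : AcceptingTree M n c') : AcceptingTree M n c
  | all (c : MachineID n R Γ) (hc : M.κ c.state = .univ)
      (hin : ∀ t ∈ M.transAt c, (applyTrans c t).isSome)
      (children : ∀ t ∈ M.transAt c, ∀ c', applyTrans c t = some c' → AcceptingTree M n c') :
      AcceptingTree M n c

/-- `M` accepts the empty tape using at most `n` cells. -/
def AcceptsEmptyTape (M : ATM R Γ) (n : ℕ) [NeZero n] : Prop :=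
  Nonempty (AcceptingTree M n (M.initID n))

end ATM

/-! ### The game -/

namespace Reduction

/-- The agents: the simulators, one for each of the `n` cells, and one last agent. -/
inductive Agent (n : ℕ) where
  | sim (i : Fin n)
  | last
deriving DecidableEq, Fintype

/-- The states of the game. `V₁` consists of `head i ex`, where `ex` says whether the machine is
in an existential state, `V₂` of `announce i g d r`, `V₃` of `choice i c`. -/
inductive GState (n : ℕ) (R Γ : Type) where
  | head (i : Fin n) (ex : Bool)
  | announce (i : Fin n) (g : Γ) (d : Dir) (r : R)
  | choice (i : Fin n) (c : Branch)
  | start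
  | base
  | goal
  | sink
deriving DecidableEq, Fintype

/-- The actions of the simulators: transition information, `*` and `X`. -/
inductive SimAction (n : ℕ) (R Γ : Type) where
  | info (i : Fin n) (g : Γ) (d : Dir) (r : R)
  | star
  | cross
deriving DecidableEq, Fintype

/-- The action sets. -/
def Act (n : ℕ) (R Γ : Type) : Agent n → Type
  | .sim _ => SimAction n R Γ
  | .last => Branch

section

variable {n : ℕ} {R Γ : Type}

instance instFintypeAct [Fintype R] [Fintype Γ] : (a : Agent n) → Fintype (Act n R Γ a)
  | .sim _ => inferInstanceAs (Fintype (SimAction n R Γ))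
  | .last => inferInstanceAs (Fintype Branch)

instance instDecidableEqAct [DecidableEq R] [DecidableEq Γ] :
    (a : Agent n) → DecidableEq (Act n R Γ a)
  | .sim _ => inferInstanceAs (DecidableEq (SimAction n R Γ))
  | .last => inferInstanceAs (DecidableEq Branch)

/-- The playing function. -/
def playing : GState n R Γ → Finset (Agent n)
  | .head i false => {.sim i}
  | .head _ true => {.last}
  | .announce _ _ _ _ => ∅
  | .choice i _ => {.sim i}
  | .start => {.last}
  | .base => ∅
  | .goal => ∅
  | .sink => ∅

theorem playing_card_le (v : GState n R Γ) : (playing v).card ≤ 1 := by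
  rcases v with ⟨i, _ | _⟩ | _ | _ | _ | _ | _ | _ <;> simp [playing]

/-- The state reached after an action of a simulator. -/
def afterSim : SimAction n R Γ → GState n R Γ
  | .info i g d r => .announce i g d r
  | .star => .goal
  | .cross => .sink

/-- The state of `V₁` for head position `i` and machine state `r`. -/
def headState (M : ATM R Γ) (i : Fin n) (r : R) : GState n R Γ :=
  .head i (decide (M.κ r = .exist))

/-- The state reached from `announce i g d r`: the head moves to the next cell, or out of
bounds. -/
def afterAnnounce (M : ATM R Γ) (i : Fin n) (d : Dir) (r : R) : GState n R Γ :=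
  match moveHead i d with
  | some i' => headState M i' r
  | none => .sink

variable [Fintype R] [Fintype Γ] [DecidableEq R] [DecidableEq Γ]

/-- From `base`, the game stays with probability `0.25` and reaches `goal` with probability
`0.75`. -/
noncomputable def baseDist : FinDist (GState n R Γ) :=
  FinDist.quarters 1 (by norm_num) .base .goal

/-- The transition function. -/
noncomputable def gameTrans [NeZero n] (M : ATM R Γ) :
    (v : GState n R Γ) → ((a : playing v) → Act n R Γ a) → FinDist (GState n R Γ)
  | .head i false, θ =>
      FinDist.point (afterSim (θ ⟨.sim i, Finset.mem_singleton_self _⟩))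
  | .head i true, θ =>
      FinDist.point (.choice i (θ ⟨.last, Finset.mem_singleton_self _⟩))
  | .choice i _, θ =>
      FinDist.point (afterSim (θ ⟨.sim i, Finset.mem_singleton_self _⟩))
  | .announce i _ d r, _ => FinDist.point (afterAnnounce M i d r)
  | .start, θ =>
      match (θ ⟨.last, Finset.mem_singleton_self _⟩ : Branch) with
      | .α => FinDist.point .base
      | .β => FinDist.point (headState M 0 M.r₀)
  | .base, _ => baseDist
  | .goal, _ => FinDist.point .goal
  | .sink, _ => FinDist.point .sink

theorem gameTrans_hasBits [NeZero n] (M : ATM R Γ) (v : GState n R Γ)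
    (θ : (a : playing v) → Act n R Γ a) : FinDistHasBits 3 (gameTrans M v θ) := by
  rcases v with ⟨i, _ | _⟩ | _ | _ | _ | _ | _ | _
  case start =>
    simp only [gameTrans]
    split <;> exact FinDist.point_hasBits _
  case base => exact FinDist.quarters_hasBits 1 (by norm_num) _ _
  all_goals exact FinDist.point_hasBits _

/-- The goals: everything for a simulator, the state `goal` for the last agent. -/
def goals : Agent n → Set (GState n R Γ)
  | .sim _ => Set.univ
  | .last => {.goal}

/-- The time horizon `3 · |Γ × (R ∪ {no state})|ⁿ + 1`. -/
def horizon (n : ℕ) (R Γ : Type) [Fintype R] [Fintype Γ] : ℕ :=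
  3 * Fintype.card (Γ × Option R) ^ n + 1

/-- The turn-based game built from the machine `M` and the number `n` of cells. -/
noncomputable def game (M : ATM R Γ) (n : ℕ) [NeZero n] :
    ConcurrentGame 1 (GState n R Γ) (Agent n) (Act n R Γ) where
  one_le_b := le_rfl
  v₀ := .start
  P := playing
  bounded := playing_card_le
  δ := gameTrans M
  L := 3
  δ_bits := gameTrans_hasBits M
  G := goals
  F := horizon n R Γ
  one_le_F := Nat.le_add_left 1 _

/-! ### The strategy profile -/

/-- The states `⟨g, r, s⟩` of the transducer of a simulator. -/
abbrev SimState (R Γ : Type) : Type := Γ × Option R × Option Branch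

/-- The initial state of the transducer of simulator `i`. -/
def simInit [NeZero n] (M : ATM R Γ) (i : Fin n) : SimState R Γ :=
  (M.blank, if i = 0 then some M.r₀ else none, none)

/-- The transition function of the transducer of simulator `i`. -/
def simStep (i : Fin n) : SimState R Γ → GState n R Γ → SimState R Γ
  | (g, _, _), .announce j g' d r' =>
      (if j = i then g' else g, if moveHead j d = some i then some r' else none, none)
  | (g, r, s), .choice j c => if j = i then (g, r, some c) else (g, r, s)
  | q, _ => q

/-- The transition information sent by simulator `i`. -/
def infoOf (i : Fin n) (t : R × Γ × Dir) : SimAction n R Γ := .info i t.2.1 t.2.2 t.1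

/-- The distribution played by simulator `i` when its transducer has registered the current
state of the game and is in state `q`. Where the output is irrelevant (no head at cell `i`, or an
existential state without a recorded choice) an arbitrary action `filler q` is played. -/
noncomputable def simOut (M : ATM R Γ) (N : M.SuccessorNaming)
    (filler : SimState R Γ → SimAction n R Γ) (i : Fin n) (q : SimState R Γ) :
    FinDist (SimAction n R Γ) :=
  match q with
  | (_, none, _) => FinDist.point (filler q)
  | (g, some r, s) =>
    match M.κ r with
    | .accept => FinDist.point .star
    | .reject => FinDist.point .cross
    | .det => FinDist.point (infoOf i (N.succ .α r g))
    | .univ =>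
      FinDist.quarters 2 (by norm_num) (infoOf i (N.succ .α r g)) (infoOf i (N.succ .β r g))
    | .exist =>
      match s with
      | none => FinDist.point (filler q)
      | some c => FinDist.point (infoOf i (N.succ c r g))

theorem simOut_hasBits (M : ATM R Γ) (N : M.SuccessorNaming)
    (filler : SimState R Γ → SimAction n R Γ) (i : Fin n) (q : SimState R Γ) :
    FinDistHasBits 3 (simOut M N filler i q) := by
  unfold simOut
  split
  · exact FinDist.point_hasBits _
  · split
    · exact FinDist.point_hasBits _
    · exact FinDist.point_hasBits _
    · exact FinDist.point_hasBits _
    · exact FinDist.quarters_hasBits _ _ _ _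
    · split <;> exact FinDist.point_hasBits _

/-- The transducer of simulator `i`. Its output takes the current state `v` of the game into
account, so that a choice announced by `v = choice i c` is obeyed at `v` itself. -/
noncomputable def simTransducer [NeZero n] (M : ATM R Γ) (N : M.SuccessorNaming)
    (filler : SimState R Γ → SimAction n R Γ) (i : Fin n) :
    Transducer (GState n R Γ) (SimAction n R Γ) 3 where
  S := SimState R Γ
  finite := inferInstance
  s₀ := simInit M i
  γ := simStep i
  O := fun q v => simOut M N filler i (simStep i q v)
  O_bits := fun _ _ => simOut_hasBits M N filler i _

/-- The transducer of the last agent, with one state: it always plays `α`. -/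
noncomputable def lastTransducer : Transducer (GState n R Γ) Branch 3 where
  S := Unit
  finite := inferInstance
  s₀ := ()
  γ := fun _ _ => ()
  O := fun _ _ => FinDist.point .α
  O_bits := fun _ _ => FinDist.point_hasBits _

/-- The tuple of transducers. -/
noncomputable def transducers [NeZero n] (M : ATM R Γ) (N : M.SuccessorNaming)
    (filler : Fin n → SimState R Γ → SimAction n R Γ) :
    (a : Agent n) → Transducer (GState n R Γ) (Act n R Γ a) 3
  | .sim i => simTransducer M N (filler i) i
  | .last => lastTransducer

/-- The strategy profile. -/
noncomputable def profile [NeZero n] (M : ATM R Γ) (N : M.SuccessorNaming)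
    (filler : Fin n → SimState R Γ → SimAction n R Γ) :
    (a : Agent n) → Strategy (GState n R Γ) (Act n R Γ a) :=
  fun a => (transducers M N filler a).strategy

end

end Reduction

/-! ### Payoffs as values of a backward recursion over histories -/

namespace ConcurrentGame

variable {b : ℕ} {V Ω : Type} [Fintype V] [DecidableEq Ω] {A : Ω → Type} [∀ i, Fintype (A i)]

/-! Simulators always receive payoff 1, so only the last agent can have a profitable deviation.
Playing `α` first gives it the chain from `base`, which misses `goal` with probability `(1/4) ^ (F -
2)`. Playing `β` first starts a simulation of `M` in which the last agent picks the existential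
successors, fair coins pick the universal ones, and the simulators jointly store the ID.

If `M` accepts, rank IDs by the least height of an accepting tree. There are fewer than `(|Γ| (|R| +
1)) ^ n` IDs, which bounds the ranks needed. Since the simulators' transducers are deterministic,
the last agent can recompute the ID from the history and choose an existential successor of smaller
rank. Every run then accepts; a machine step costs at most three game steps, so the horizon suffices
and the payoff is 1 (`Encodes.value_simulate`).

If `M` does not accept, every universal ID without an accepting tree has a bad successor, hit with
probability at least 1/2, while at an existential ID every choice is bad. Hence against any
strategy, however randomised or history-dependent, the simulation fails within `k` steps with
probability at least `2 ^ (-k)` (`Encodes.value_le`). This exceeds the failure probability at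
`base`, because `(1/4) ^ k = (1/2) ^ (2 * k)`; mixing both options at `start` cannot help either.

Both estimates are inductions on remaining time, made possible by `payoff_eq_reachValue`. -/

/-- The probability that the active agents at `v` choose the actions `θ` after the history `w`. -/
noncomputable def actionProb (𝔾 : ConcurrentGame b V Ω A) (π : (i : Ω) → Strategy V (A i))
    {m : ℕ} (w : Fin (m + 1) → V) (v : V) (θ : (i : 𝔾.P v) → A i) : ℝ :=
  ∏ i : 𝔾.P v, π i m w (θ i)

/-- The probability of moving to `v` after the history `w`. -/
noncomputable def stepProb (𝔾 : ConcurrentGame b V Ω A) (π : (i : Ω) → Strategy V (A i))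
    {m : ℕ} (w : Fin (m + 1) → V) (v : V) : ℝ :=
  ∑ θ : (i : 𝔾.P (w (Fin.last m))) → A i,
    𝔾.actionProb π w (w (Fin.last m)) θ * 𝔾.δ (w (Fin.last m)) θ v

theorem sum_actionProb (𝔾 : ConcurrentGame b V Ω A) (π : (i : Ω) → Strategy V (A i))
    {m : ℕ} (w : Fin (m + 1) → V) (v : V) : ∑ θ, 𝔾.actionProb π w v θ = 1 := by
  have h := Finset.prod_univ_sum (fun i : 𝔾.P v => (Finset.univ : Finset (A i)))
    (fun i a => π i m w a)
  rw [Fintype.piFinset_univ] at h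
  unfold actionProb
  rw [← h]
  exact Finset.prod_eq_one fun i _ => stdSimplex.sum_eq_one (π i m w)

theorem sum_stepProb_mul (𝔾 : ConcurrentGame b V Ω A) (π : (i : Ω) → Strategy V (A i))
    {m : ℕ} (w : Fin (m + 1) → V) (f : V → ℝ) :
    ∑ v, 𝔾.stepProb π w v * f v = ∑ θ, 𝔾.actionProb π w (w (Fin.last m)) θ *
      ∑ v, 𝔾.δ (w (Fin.last m)) θ v * f v := by
  simp only [stepProb, Finset.sum_mul, Finset.mul_sum]
  rw [Finset.sum_comm]
  simp only [mul_assoc]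

theorem sum_stepProb (𝔾 : ConcurrentGame b V Ω A) (π : (i : Ω) → Strategy V (A i))
    {m : ℕ} (w : Fin (m + 1) → V) : ∑ v, 𝔾.stepProb π w v = 1 := by
  have h := 𝔾.sum_stepProb_mul π w (fun _ => 1)
  simp only [mul_one] at h
  rw [h, ← 𝔾.sum_actionProb π w (w (Fin.last m))]
  exact Finset.sum_congr rfl fun θ _ => by
    rw [stdSimplex.sum_eq_one (𝔾.δ (w (Fin.last m)) θ), mul_one]

open Classical in
/-- The probability that, after the history `w`, the goal of Agent `i` is visited now or in one of
the next `k` steps. -/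
noncomputable def reachValue (𝔾 : ConcurrentGame b V Ω A) (π : (i : Ω) → Strategy V (A i))
    (i : Ω) : ℕ → {m : ℕ} → (Fin (m + 1) → V) → ℝ
  | 0, m, w => if w (Fin.last m) ∈ 𝔾.G i then 1 else 0
  | k + 1, m, w => if w (Fin.last m) ∈ 𝔾.G i then 1 else
      ∑ v, 𝔾.stepProb π w v * reachValue 𝔾 π i k (Fin.snoc (α := fun _ => V) w v)

theorem reachValue_of_mem (𝔾 : ConcurrentGame b V Ω A) (π : (i : Ω) → Strategy V (A i))
    (i : Ω) (k : ℕ) {m : ℕ} {w : Fin (m + 1) → V} (h : w (Fin.last m) ∈ 𝔾.G i) :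
    𝔾.reachValue π i k w = 1 := by
  cases k <;> simp [reachValue, h]

theorem reachValue_zero (𝔾 : ConcurrentGame b V Ω A) (π : (i : Ω) → Strategy V (A i))
    (i : Ω) {m : ℕ} {w : Fin (m + 1) → V} (h : w (Fin.last m) ∉ 𝔾.G i) :
    𝔾.reachValue π i 0 w = 0 := by
  simp [reachValue, h]

theorem reachValue_succ (𝔾 : ConcurrentGame b V Ω A) (π : (i : Ω) → Strategy V (A i))
    (i : Ω) (k : ℕ) {m : ℕ} {w : Fin (m + 1) → V} (h : w (Fin.last m) ∉ 𝔾.G i) :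
    𝔾.reachValue π i (k + 1) w = ∑ θ, 𝔾.actionProb π w (w (Fin.last m)) θ *
      ∑ v, 𝔾.δ (w (Fin.last m)) θ v *
        𝔾.reachValue π i k (Fin.snoc (α := fun _ => V) w v) := by
  rw [reachValue, if_neg h, sum_stepProb_mul]

theorem stepProb_nonneg (𝔾 : ConcurrentGame b V Ω A) (π : (i : Ω) → Strategy V (A i))
    {m : ℕ} (w : Fin (m + 1) → V) (v : V) : 0 ≤ 𝔾.stepProb π w v :=
  Finset.sum_nonneg fun θ _ => mul_nonneg
    (Finset.prod_nonneg fun i _ => (π i m w).2.1 (θ i)) ((𝔾.δ (w (Fin.last m)) θ).2.1 v)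

theorem reachValue_le_one (𝔾 : ConcurrentGame b V Ω A) (π : (i : Ω) → Strategy V (A i))
    (i : Ω) (k : ℕ) {m : ℕ} (w : Fin (m + 1) → V) : 𝔾.reachValue π i k w ≤ 1 := by
  induction k generalizing m with
  | zero => rw [reachValue]; split_ifs <;> norm_num
  | succ k ih =>
    rw [reachValue]
    split_ifs
    · exact le_rfl
    · rw [← 𝔾.sum_stepProb π w]
      exact Finset.sum_le_sum fun v _ =>
        mul_le_of_le_one_right (𝔾.stepProb_nonneg π w v) (ih _)

variable [DecidableEq V]

/-- The expectation of a function of the first `m + 1` states of a play. -/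
noncomputable def expect (𝔾 : ConcurrentGame b V Ω A) (π : (i : Ω) → Strategy V (A i))
    (m : ℕ) (f : (Fin (m + 1) → V) → ℝ) : ℝ :=
  ∑ s : Fin (m + 1) → V, ((if s 0 = 𝔾.v₀ then 1 else 0) *
    ∏ k : Fin m, 𝔾.stepProb π (prefixUpTo s k) (s k.succ)) * f s

theorem expect_zero (𝔾 : ConcurrentGame b V Ω A) (π : (i : Ω) → Strategy V (A i))
    (f : (Fin 1 → V) → ℝ) : 𝔾.expect π 0 f = f fun _ => 𝔾.v₀ := by
  unfold expect
  rw [Finset.sum_eq_single (fun _ => 𝔾.v₀)]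
  · simp
  · intro s _ hs
    have : s 0 ≠ 𝔾.v₀ := fun h => hs (by funext j; rw [show j = 0 from Fin.fin_one_eq_zero j, h])
    simp [this]
  · simp

/-- Integrates out the last state: the other factors of the path probability involve only proper
prefixes, so appending a letter leaves them unchanged. -/
theorem expect_succ (𝔾 : ConcurrentGame b V Ω A) (π : (i : Ω) → Strategy V (A i)) (m : ℕ)
    (f : (Fin (m + 2) → V) → ℝ) : 𝔾.expect π (m + 1) f = 𝔾.expect π m
      fun w => ∑ v, 𝔾.stepProb π w v * f (Fin.snoc (α := fun _ => V) w v) := by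
  unfold expect
  rw [← (Fin.snocEquiv (fun _ : Fin (m + 2) => V)).sum_comp, Fintype.sum_prod_type,
    Finset.sum_comm]
  refine Finset.sum_congr rfl fun w _ => ?_
  rw [Finset.mul_sum]
  refine Finset.sum_congr rfl fun v _ => ?_
  simp only [Fin.snocEquiv, Equiv.coe_fn_mk]
  rw [Fin.prod_univ_castSucc]
  have hpre : ∀ k : Fin m, prefixUpTo (Fin.snoc (α := fun _ => V) w v) k.castSucc
      = prefixUpTo w k := by
    intro k
    funext j
    change Fin.snoc (α := fun _ => V) w v (Fin.castLE _ j) = w (Fin.castLE _ j)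
    have : (Fin.castLE (by have := k.isLt; simp; omega) j : Fin (m + 2))
        = (Fin.castLE (by have := k.isLt; omega) j : Fin (m + 1)).castSucc := rfl
    rw [this, Fin.snoc_castSucc]
  have hlast : prefixUpTo (Fin.snoc (α := fun _ => V) w v) (Fin.last m) = w := by
    funext j
    change Fin.snoc (α := fun _ => V) w v j.castSucc = w j
    rw [Fin.snoc_castSucc]
  have h0 : Fin.snoc (α := fun _ => V) w v 0 = w 0 := by
    have : (0 : Fin (m + 2)) = (0 : Fin (m + 1)).castSucc := rfl
    rw [this, Fin.snoc_castSucc]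
  have hs : ∀ k : Fin m, Fin.snoc (α := fun _ => V) w v k.castSucc.succ = w k.succ := by
    intro k
    rw [Fin.succ_castSucc, Fin.snoc_castSucc]
  have hl : Fin.snoc (α := fun _ => V) w v (Fin.last m).succ = v := by
    rw [Fin.succ_last, Fin.snoc_last]
  simp only [h0, hs, hl, hpre]
  have : 𝔾.stepProb π (prefixUpTo (Fin.snoc (α := fun _ => V) w v) (Fin.last m)) v
      = 𝔾.stepProb π w v := congrArg (fun w' : Fin (m + 1) → V => 𝔾.stepProb π w' v) hlast
  rw [this]
  ring

open Classical in
-- Strategies see only states, not actions. With the state sequence fixed, the sum over action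
-- sequences therefore factors into one sum per step.
theorem payoff_eq_expect (𝔾 : ConcurrentGame b V Ω A) (π : (i : Ω) → Strategy V (A i)) (i : Ω) :
    𝔾.payoff π i = 𝔾.expect π (𝔾.F - 1) fun s => if ∃ k, s k ∈ 𝔾.G i then 1 else 0 := by
  unfold payoff expect
  rw [Fintype.sum_sigma]
  refine Finset.sum_congr rfl fun s _ => ?_
  have hplay : ∀ y, 𝔾.playProb π ⟨s, y⟩ * 𝔾.playPayoff ⟨s, y⟩ i =
      ((if s 0 = 𝔾.v₀ then 1 else 0) * ∏ k : Fin (𝔾.F - 1),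
        ((∏ i : 𝔾.P (s k.castSucc), π i k.val (prefixUpTo s k) (y k i)) *
          𝔾.δ (s k.castSucc) (y k) (s k.succ))) * if ∃ k, s k ∈ 𝔾.G i then 1 else 0 :=
    fun _ => rfl
  simp only [hplay]
  rw [← Finset.sum_mul, ← Finset.mul_sum]
  congr 2
  have h := Finset.prod_univ_sum
    (fun k : Fin (𝔾.F - 1) => (Finset.univ : Finset ((i : 𝔾.P (s k.castSucc)) → A i)))
    (fun k θ => (∏ i : 𝔾.P (s k.castSucc), π i k.val (prefixUpTo s k) (θ i)) *
        𝔾.δ (s k.castSucc) θ (s k.succ))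
  rw [Fintype.piFinset_univ] at h
  rw [← h]
  rfl

open Classical in
-- The conditional probability of a visit, given the first `m + 1` states, has the same mean for
-- every `m`. Lowering `m` to zero turns the path sum into the recursive value.
theorem expect_visit_eq (𝔾 : ConcurrentGame b V Ω A) (π : (i : Ω) → Strategy V (A i)) (i : Ω)
    {N : ℕ} (k m : ℕ) (hN : m + k = N) :
    𝔾.expect π N (fun s => if ∃ k, s k ∈ 𝔾.G i then 1 else 0) =
      𝔾.expect π m fun w => if ∃ k, w k ∈ 𝔾.G i then 1 else 𝔾.reachValue π i k w := by
  induction k generalizing m with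
  | zero =>
    obtain rfl : m = N := hN
    congr 1
    funext w
    split_ifs with h
    · rfl
    · rw [reachValue_zero _ _ _ fun hw => h ⟨_, hw⟩]
  | succ k ih =>
    rw [ih (m + 1) (by omega), expect_succ]
    congr 1
    funext w
    split_ifs with h
    · refine Eq.trans ?_ (𝔾.sum_stepProb π w)
      refine Finset.sum_congr rfl fun v _ => ?_
      obtain ⟨j, hj⟩ := h
      rw [if_pos ⟨j.castSucc, by rwa [Fin.snoc_castSucc]⟩, mul_one]
    · rw [reachValue, if_neg fun hw => h ⟨_, hw⟩]
      refine Finset.sum_congr rfl fun v _ => ?_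
      split_ifs with h'
      · obtain ⟨j, hj⟩ := h'
        rw [reachValue_of_mem]
        -- The old history has no visit, so a visit in the extended one must be at the new letter.
        induction j using Fin.lastCases with
        | last => exact hj
        | cast j => rw [Fin.snoc_castSucc] at hj; exact absurd ⟨j, hj⟩ h
      · rfl

theorem payoff_eq_reachValue (𝔾 : ConcurrentGame b V Ω A) (π : (i : Ω) → Strategy V (A i))
    (i : Ω) : 𝔾.payoff π i = 𝔾.reachValue π i (𝔾.F - 1) (m := 0) fun _ => 𝔾.v₀ := by
  rw [payoff_eq_expect, expect_visit_eq 𝔾 π i (𝔾.F - 1) 0 (by omega), expect_zero]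
  split_ifs with h
  · obtain ⟨_, h⟩ := h
    rw [reachValue_of_mem _ _ _ _ h]
  · rfl

end ConcurrentGame

/-! ### Sums against point masses, two-point distributions and single-agent action tuples -/

namespace FinDist

theorem sum_point_mul {X : Type} [Fintype X] [DecidableEq X] (x : X) (f : X → ℝ) :
    ∑ y, FinDist.point x y * f y = f x := by
  change ∑ y, (Pi.single x 1 : X → ℝ) y * f y = f x
  simp [Pi.single_apply]

theorem sum_quarters_mul {X : Type} [Fintype X] [DecidableEq X] (k : ℕ) (hk : k ≤ 4) (x y : X)
    (f : X → ℝ) : ∑ z, FinDist.quarters k hk x y z * f z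
      = (k : ℝ) / 4 * f x + (1 - (k : ℝ) / 4) * f y := by
  change ∑ z, ((k : ℝ) / 4 * (Pi.single x 1 : X → ℝ) z
      + (1 - (k : ℝ) / 4) * (Pi.single y 1 : X → ℝ) z) * f z = _
  simp [Pi.single_apply, add_mul, Finset.sum_add_distrib]

end FinDist

namespace Reduction

theorem sum_pi_singleton {Ω : Type} [DecidableEq Ω] {A : Ω → Type} [∀ i, Fintype (A i)] (a : Ω)
    (p : (i : Ω) → A i → ℝ) (f : A a → ℝ) :
    ∑ θ : (i : ({a} : Finset Ω)) → A i,
      (∏ i : ({a} : Finset Ω), p i (θ i)) * f (θ ⟨a, Finset.mem_singleton_self a⟩) =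
        ∑ x, p a x * f x := by
  let : Unique ({a} : Finset Ω) :=
    ⟨⟨⟨a, Finset.mem_singleton_self a⟩⟩, fun x => Subtype.ext (Finset.mem_singleton.mp x.2)⟩
  refine Fintype.sum_equiv (Equiv.piUnique fun i : ({a} : Finset Ω) => A i) _ _ fun θ => ?_
  rw [Fintype.prod_unique]
  rfl

theorem sum_pi_empty {Ω : Type} [DecidableEq Ω] {A : Ω → Type} [∀ i, Fintype (A i)]
    (p : (i : Ω) → A i → ℝ) (c : ℝ) :
    ∑ θ : (i : (∅ : Finset Ω)) → A i, (∏ i : (∅ : Finset Ω), p i (θ i)) * c = c := by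
  simp

/-! ### One-step recursions for the last agent's value at each kind of game state -/

variable {n : ℕ} {R Γ : Type}

/-- The history `w` continued with the state `v`. -/
abbrev extend {m : ℕ} (w : Fin (m + 1) → GState n R Γ) (v : GState n R Γ) :
    Fin (m + 2) → GState n R Γ :=
  Fin.snoc (α := fun _ => GState n R Γ) w v

variable [NeZero n]

/-- The state of the transducer of simulator `i` after reading all of the history `w`. -/
def simState (M : ATM R Γ) {m : ℕ} (w : Fin (m + 1) → GState n R Γ) (i : Fin n) : SimState R Γ :=
  (List.ofFn w).foldl (simStep i) (simInit M i)

theorem simState_extend (M : ATM R Γ) {m : ℕ} (w : Fin (m + 1) → GState n R Γ)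
    (v : GState n R Γ) (i : Fin n) :
    simState M (extend w v) i = simStep i (simState M w i) v := by
  unfold simState extend
  rw [List.ofFn_succ']
  simp

variable [Fintype R] [Fintype Γ] [DecidableEq R] [DecidableEq Γ]

/-- A transducer's state lags one letter behind the history, but the simulators' output function
first applies `simStep` to the current letter, which makes up the lag. -/
theorem profile_sim (M : ATM R Γ) (N : M.SuccessorNaming)
    (filler : Fin n → SimState R Γ → SimAction n R Γ) (i : Fin n) {m : ℕ}
    (w : Fin (m + 1) → GState n R Γ) :
    profile M N filler (.sim i) m w = simOut M N (filler i) i (simState M w i) := by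
  change simOut M N (filler i) i (simStep i
    ((List.ofFn fun j : Fin m => w j.castSucc).foldl (simStep i) (simInit M i)) _) = _
  unfold simState
  rw [List.ofFn_succ' w]
  simp

/-- The profile in which the last agent deviates to `σ`. -/
noncomputable def deviation (M : ATM R Γ) (N : M.SuccessorNaming)
    (filler : Fin n → SimState R Γ → SimAction n R Γ)
    (σ : Strategy (GState n R Γ) (Act n R Γ .last)) :
    (a : Agent n) → Strategy (GState n R Γ) (Act n R Γ a) :=
  Function.update (profile M N filler) .last σ

theorem deviation_last (M : ATM R Γ) (N : M.SuccessorNaming)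
    (filler : Fin n → SimState R Γ → SimAction n R Γ)
    (σ : Strategy (GState n R Γ) (Act n R Γ .last)) : deviation M N filler σ .last = σ :=
  Function.update_self _ _ _

theorem deviation_sim (M : ATM R Γ) (N : M.SuccessorNaming)
    (filler : Fin n → SimState R Γ → SimAction n R Γ)
    (σ : Strategy (GState n R Γ) (Act n R Γ .last)) (i : Fin n) :
    deviation M N filler σ (.sim i) = profile M N filler (.sim i) :=
  Function.update_of_ne (by simp) _ _

/-- The probability that the last agent reaches its goal within `k` steps after the history `w`,
when it plays `σ` against the simulators. -/
noncomputable def value (M : ATM R Γ) (N : M.SuccessorNaming)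
    (filler : Fin n → SimState R Γ → SimAction n R Γ)
    (σ : Strategy (GState n R Γ) (Act n R Γ .last)) (k : ℕ)
    {m : ℕ} (w : Fin (m + 1) → GState n R Γ) : ℝ :=
  (game M n).reachValue (deviation M N filler σ) .last k w

section

variable (M : ATM R Γ) (N : M.SuccessorNaming)
  (filler : Fin n → SimState R Γ → SimAction n R Γ)
  (σ : Strategy (GState n R Γ) (Act n R Γ .last))
  (k : ℕ) {m : ℕ} {w : Fin (m + 1) → GState n R Γ}

theorem value_goal (hw : w (Fin.last m) = .goal) : value M N filler σ k w = 1 :=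
  ConcurrentGame.reachValue_of_mem _ _ _ _ hw

theorem value_le_one : value M N filler σ k w ≤ 1 :=
  ConcurrentGame.reachValue_le_one _ _ _ _ _

theorem value_zero (hw : w (Fin.last m) ≠ .goal) : value M N filler σ 0 w = 0 :=
  ConcurrentGame.reachValue_zero _ _ _ hw

/-- The recursion of `value`, with the current state `v` as a variable. -/
theorem value_succ {v : GState n R Γ} (hw : w (Fin.last m) = v) (hv : v ≠ .goal) :
    value M N filler σ (k + 1) w = ∑ θ : (a : playing v) → Act n R Γ a,
      (∏ a : playing v, deviation M N filler σ a m w (θ a)) *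
        ∑ u, gameTrans M v θ u * value M N filler σ k (extend w u) := by
  subst hw
  exact ConcurrentGame.reachValue_succ _ _ _ _ hv

theorem value_sim {i : Fin n} {v : GState n R Γ}
    (hw : w (Fin.last m) = v) (hv : v = .head i false ∨ ∃ c, v = .choice i c) :
    value M N filler σ (k + 1) w =
      ∑ a, simOut M N (filler i) i (simState M w i) a *
        value M N filler σ k (extend w (afterSim a)) := by
  obtain rfl | ⟨c, rfl⟩ := hv <;>
  · rw [value_succ M N filler σ k hw (by simp), ← profile_sim M N filler i w]
    refine Eq.trans ?_ ((sum_pi_singleton (A := Act n R Γ) (.sim i)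
      (fun a x => deviation M N filler σ a m w x)
      (fun x => value M N filler σ k (extend w (afterSim x)))).trans ?_)
    · refine Finset.sum_congr rfl fun θ _ => ?_
      congr 1
      exact FinDist.sum_point_mul _ _
    · simp only [deviation_sim]
      rfl

theorem value_announce {i : Fin n} {g : Γ} {d : Dir} {r : R}
    (hw : w (Fin.last m) = .announce i g d r) :
    value M N filler σ (k + 1) w = value M N filler σ k (extend w (afterAnnounce M i d r)) := by
  rw [value_succ M N filler σ k hw (by simp)]
  refine Eq.trans ?_ (sum_pi_empty (A := Act n R Γ)
    (fun a x => deviation M N filler σ a m w x) _)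
  refine Finset.sum_congr rfl fun θ _ => ?_
  congr 1
  exact FinDist.sum_point_mul _ _

theorem value_sink (hw : w (Fin.last m) = .sink) : value M N filler σ k w = 0 := by
  induction k generalizing m w with
  | zero => exact value_zero _ _ _ _ (by simp [hw])
  | succ k ih =>
    rw [value_succ M N filler σ k hw (by simp)]
    refine Eq.trans ?_ (sum_pi_empty (A := Act n R Γ)
      (fun a x => deviation M N filler σ a m w x) _)
    refine Finset.sum_congr rfl fun θ _ => ?_
    congr 1
    refine (FinDist.sum_point_mul _ _).trans (ih ?_)
    simp

/-- Each step misses `goal` with probability 1/4, independently. -/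
theorem value_base (hw : w (Fin.last m) = .base) :
    value M N filler σ k w = 1 - (1 / 4 : ℝ) ^ k := by
  induction k generalizing m w with
  | zero => rw [value_zero _ _ _ _ (by simp [hw])]; norm_num
  | succ k ih =>
    rw [value_succ M N filler σ k hw (by simp)]
    refine Eq.trans ?_ (sum_pi_empty (A := Act n R Γ)
      (fun a x => deviation M N filler σ a m w x) _)
    refine Finset.sum_congr rfl fun θ _ => ?_
    congr 1
    refine (FinDist.sum_quarters_mul 1 (by norm_num) GState.base GState.goal fun u =>
      value M N filler σ k (extend w u)).trans ?_
    rw [ih (by simp), value_goal _ _ _ _ _ (by simp)]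
    push_cast
    ring

theorem sum_branch (f : Branch → ℝ) : ∑ c, f c = f .α + f .β := by
  change ∑ c ∈ {Branch.α, Branch.β}, f c = _
  simp

theorem value_head_exist {i : Fin n} (hw : w (Fin.last m) = .head i true) :
    value M N filler σ (k + 1) w =
      σ m w Branch.α * value M N filler σ k (extend w (.choice i .α)) +
      σ m w Branch.β * value M N filler σ k (extend w (.choice i .β)) := by
  rw [value_succ M N filler σ k hw (by simp)]
  refine Eq.trans ?_ ((sum_pi_singleton (A := Act n R Γ) .last
    (fun a x => deviation M N filler σ a m w x)
    (fun x => value M N filler σ k (extend w (.choice i x)))).trans ?_)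
  · refine Finset.sum_congr rfl fun θ _ => ?_
    congr 1
    exact FinDist.sum_point_mul _ _
  · simp only [deviation_last]
    exact sum_branch _

theorem value_start (hw : w (Fin.last m) = .start) :
    value M N filler σ (k + 1) w =
      σ m w Branch.α * value M N filler σ k (extend w .base) +
      σ m w Branch.β * value M N filler σ k (extend w (headState M 0 M.r₀)) := by
  rw [value_succ M N filler σ k hw (by simp)]
  refine Eq.trans ?_ ((sum_pi_singleton (A := Act n R Γ) .last
    (fun a x => deviation M N filler σ a m w x)
    (fun x : Branch => match x with
      | .α => value M N filler σ k (extend w .base)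
      | .β => value M N filler σ k (extend w (headState M 0 M.r₀)))).trans ?_)
  · refine Finset.sum_congr rfl fun θ _ => ?_
    congr 1
    -- The action is generalised to a variable so that the `match` in `gameTrans` reduces by cases.
    have h : ∀ x : Branch, θ ⟨.last, Finset.mem_singleton_self _⟩ = x →
        ∑ u, gameTrans M .start θ u * value M N filler σ k (extend w u) =
          match x with
          | .α => value M N filler σ k (extend w .base)
          | .β => value M N filler σ k (extend w (headState M 0 M.r₀)) := by
      rintro (_ | _) hx <;>
      · simp only [gameTrans, hx]
        exact FinDist.sum_point_mul _ _
    exact h _ rfl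
  · simp only [deviation_last]
    exact sum_branch _

theorem payoff_deviation :
    (game M n).payoff (deviation M N filler σ) .last =
      value M N filler σ (horizon n R Γ - 1) (m := 0) fun _ => .start :=
  ConcurrentGame.payoff_eq_reachValue _ _ _

theorem payoff_sim (π : (a : Agent n) → Strategy (GState n R Γ) (Act n R Γ a)) (i : Fin n) :
    (game M n).payoff π (.sim i) = 1 := by
  rw [ConcurrentGame.payoff_eq_reachValue]
  exact ConcurrentGame.reachValue_of_mem _ _ _ _ (Set.mem_univ _)

end

end Reduction

/-! ### Accepting IDs ranked by tree height -/

namespace ATM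

variable {R Γ : Type} {n : ℕ}

/-- The IDs with an accepting computation tree of height less than `d`. -/
def acceptingWithin (M : ATM R Γ) : ℕ → Set (MachineID n R Γ)
  | 0 => ∅
  | d + 1 => {c | M.κ c.state = .accept ∨
      ((M.κ c.state = .exist ∨ M.κ c.state = .det) ∧
        ∃ t ∈ M.transAt c, ∃ c', applyTrans c t = some c' ∧ c' ∈ M.acceptingWithin d) ∨
      (M.κ c.state = .univ ∧
        ∀ t ∈ M.transAt c, ∃ c', applyTrans c t = some c' ∧ c' ∈ M.acceptingWithin d)}

theorem acceptingWithin_subset_succ (M : ATM R Γ) (d : ℕ) :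
    (M.acceptingWithin d : Set (MachineID n R Γ)) ⊆ M.acceptingWithin (d + 1) := by
  induction d with
  | zero => exact Set.empty_subset _
  | succ d ih =>
    rintro c (h | ⟨h, t, ht, c', hc', hd⟩ | ⟨h, ht⟩)
    · exact Or.inl h
    · exact Or.inr (Or.inl ⟨h, t, ht, c', hc', ih hd⟩)
    · refine Or.inr (Or.inr ⟨h, fun t htr => ?_⟩)
      obtain ⟨c', hc', hd⟩ := ht t htr
      exact ⟨c', hc', ih hd⟩

theorem acceptingWithin_mono (M : ATM R Γ) :
    Monotone fun d => (M.acceptingWithin d : Set (MachineID n R Γ)) :=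
  monotone_nat_of_le_succ M.acceptingWithin_subset_succ

theorem SuccessorNaming.mem_transAt {M : ATM R Γ} (N : M.SuccessorNaming) {c : MachineID n R Γ}
    (h : M.κ c.state = .det ∨ M.κ c.state = .exist ∨ M.κ c.state = .univ) (t : R × Γ × Dir) :
    t ∈ M.transAt c ↔ ∃ b, t = N.succ b c.state (c.tape c.head) := by
  unfold transAt
  rw [N.spec _ _ h]
  constructor
  · rintro (h | h)
    · exact ⟨_, h⟩
    · exact ⟨_, h⟩
  · rintro ⟨_ | _, rfl⟩ <;> simp

theorem exists_mem_acceptingWithin {M : ATM R Γ} (N : M.SuccessorNaming) {c : MachineID n R Γ}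
    (T : AcceptingTree M n c) : ∃ d, c ∈ M.acceptingWithin d := by
  induction T with
  | leaf c hc => exact ⟨1, Or.inl hc⟩
  | choose c hc t ht c' hc' child ih =>
    obtain ⟨d, hd⟩ := ih
    exact ⟨d + 1, Or.inr (Or.inl ⟨hc, t, ht, c', hc', hd⟩)⟩
  | all c hc hin children ih =>
    have h : ∀ b, ∃ d, ∃ c', applyTrans c (N.succ b c.state (c.tape c.head)) = some c' ∧
        c' ∈ M.acceptingWithin d := by
      intro b
      have ht := (N.mem_transAt (.inr (.inr hc)) _).mpr ⟨b, rfl⟩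
      obtain ⟨c', hc'⟩ := Option.isSome_iff_exists.mp (hin _ ht)
      obtain ⟨d, hd⟩ := ih _ ht c' hc'
      exact ⟨d, c', hc', hd⟩
    -- The two named successors exhaust all transitions, so one maximum bounds the heights of all
    -- children.
    choose d hd using h
    refine ⟨max (d .α) (d .β) + 1, Or.inr (Or.inr ⟨hc, fun t ht => ?_⟩)⟩
    obtain ⟨b, rfl⟩ := (N.mem_transAt (.inr (.inr hc)) _).mp ht
    obtain ⟨c', hc', hm⟩ := hd b
    refine ⟨c', hc', M.acceptingWithin_mono ?_ hm⟩
    cases b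
    · exact le_max_left _ _
    · exact le_max_right _ _

/-- IDs as tuples. -/
def machineIDEquiv : MachineID n R Γ ≃ (Fin n → Γ) × Fin n × R where
  toFun c := (c.tape, c.head, c.state)
  invFun p := ⟨p.1, p.2.1, p.2.2⟩

/-- After cancelling `|Γ| ^ n`, this is Bernoulli's inequality `1 + n |R| ≤ (1 + |R|) ^ n`. -/
theorem card_machineID_lt [Fintype R] [Fintype Γ] (M : ATM R Γ) :
    Nat.card (MachineID n R Γ) < Fintype.card (Γ × Option R) ^ n := by
  have hΓ : 0 < Fintype.card Γ := Fintype.card_pos_iff.mpr ⟨M.blank⟩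
  rw [Nat.card_congr machineIDEquiv, Nat.card_eq_fintype_card]
  simp only [Fintype.card_prod, Fintype.card_option, Fintype.card_fun, Fintype.card_fin]
  rw [mul_pow]
  refine Nat.mul_lt_mul_of_pos_left ?_ (pow_pos hΓ n)
  have h := one_add_mul_le_pow (a := (Fintype.card R : ℤ)) (by omega) n
  have h' : 1 + n * Fintype.card R ≤ (1 + Fintype.card R) ^ n := by exact_mod_cast h
  rw [add_comm (Fintype.card R) 1]
  omega

/-- Each level is determined by the previous one, so the increasing chain is constant once two
consecutive levels agree. Until then it gains an ID at every step. -/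
theorem mem_acceptingWithin_card [Fintype R] [Fintype Γ] (M : ATM R Γ) {c : MachineID n R Γ}
    {d : ℕ} (hc : c ∈ M.acceptingWithin d) :
    c ∈ M.acceptingWithin (Nat.card (MachineID n R Γ)) := by
  have : Finite (MachineID n R Γ) := Finite.of_equiv _ machineIDEquiv.symm
  obtain hd | hd := le_total d (Nat.card (MachineID n R Γ))
  · exact M.acceptingWithin_mono hd hc
  have hcard := Nat.stabilises_of_monotone
    (f := fun d => (M.acceptingWithin d : Set (MachineID n R Γ)).ncard)
    (fun a b hab => Set.ncard_le_ncard (M.acceptingWithin_mono hab))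
    (fun _ => Set.ncard_le_card _)
    (fun m hm => by
      have heq : (M.acceptingWithin m : Set (MachineID n R Γ)) = M.acceptingWithin (m + 1) :=
        Set.eq_of_subset_of_ncard_le (M.acceptingWithin_subset_succ m) hm.ge
      change (M.acceptingWithin (m + 1) : Set (MachineID n R Γ)).ncard = _
      rw [acceptingWithin, heq]
      rfl) hd
  exact (Set.eq_of_subset_of_ncard_le (M.acceptingWithin_mono hd) hcard.le).symm.subset hc

/-- A successor witnessing the least possible height works for every larger bound by monotonicity.
Hence the choice depends on the ID alone and not on `d`. -/
theorem exists_decreasing_choice {M : ATM R Γ} (N : M.SuccessorNaming) :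
    ∃ best : MachineID n R Γ → Branch, ∀ c, M.κ c.state = .exist →
      ∀ d, c ∈ M.acceptingWithin (d + 1) →
        ∃ c', applyTrans c (N.succ (best c) c.state (c.tape c.head)) = some c' ∧
          c' ∈ M.acceptingWithin d := by
  classical
  refine Classical.axiom_of_choice (r := fun (c : MachineID n R Γ) b => M.κ c.state = .exist →
      ∀ d, c ∈ M.acceptingWithin (d + 1) →
        ∃ c', applyTrans c (N.succ b c.state (c.tape c.head)) = some c' ∧
          c' ∈ M.acceptingWithin d) fun c => ?_
  by_cases h : M.κ c.state = .exist ∧ ∃ d, c ∈ M.acceptingWithin (d + 1)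
  · obtain ⟨hc, hex⟩ := h
    have hfind := Nat.find_spec hex
    rcases hfind with h | ⟨_, t, ht, c', hc', hd⟩ | ⟨h, _⟩
    · simp [hc] at h
    · obtain ⟨b, rfl⟩ := (N.mem_transAt (.inr (.inl hc)) _).mp ht
      exact ⟨b, fun _ d hcd => ⟨c', hc', M.acceptingWithin_mono (Nat.find_min' hex hcd) hd⟩⟩
    · simp [hc] at h
  · exact ⟨.α, fun hc d hd => absurd ⟨hc, d, hd⟩ h⟩

end ATM

/-! ### Histories that encode machine IDs -/

namespace Reduction

variable {n : ℕ} {R Γ : Type} [NeZero n]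

/-- After the history `w`, the transducers have registered the ID `c` and the machine is about to
make a transition. -/
def Encodes (M : ATM R Γ) {m : ℕ} (w : Fin (m + 1) → GState n R Γ) (c : MachineID n R Γ) : Prop :=
  w (Fin.last m) = headState M c.head c.state ∧
    ∀ j, simState M w j = (c.tape j, if c.head = j then some c.state else none, none)

variable {M : ATM R Γ} {m : ℕ} {w : Fin (m + 1) → GState n R Γ} {c c' : MachineID n R Γ}

theorem encodes_initID : Encodes M (extend (fun _ : Fin 1 => GState.start) (headState M 0 M.r₀))
    (M.initID n) := by
  refine ⟨Fin.snoc_last (α := fun _ => GState n R Γ) _ _, fun j => ?_⟩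
  rw [simState_extend]
  simp [simState, headState, simStep, simInit, ATM.initID, eq_comm]

/-- An announcement overwrites the machine state and the recorded choice in every transducer, so
only the tape need be correct beforehand. This covers histories ending in `choice` as well as
encoding ones. -/
theorem encodes_extend (hw : ∀ j, (simState M w j).1 = c.tape j) {t : R × Γ × Dir}
    (ht : ATM.applyTrans c t = some c') :
    Encodes M (extend (extend w (.announce c.head t.2.1 t.2.2 t.1))
      (headState M c'.head c'.state)) c' := by
  obtain ⟨i, hi, rfl⟩ := Option.map_eq_some_iff.mp ht
  refine ⟨by simp, fun j => ?_⟩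
  rw [simState_extend, simState_extend]
  have hj := hw j
  generalize simState M w j = q at hj ⊢
  obtain ⟨g, r, s⟩ := q
  change g = c.tape j at hj
  subst hj
  simp only [headState, simStep, hi, Option.some.injEq, Function.update_apply, eq_comm]

theorem Encodes.tape_eq (hw : Encodes M w c) (j : Fin n) : (simState M w j).1 = c.tape j := by
  rw [hw.2]

theorem Encodes.tape_eq_choice (hw : Encodes M w c) (b : Branch) (j : Fin n) :
    (simState M (extend w (.choice c.head b)) j).1 = c.tape j := by
  rw [simState_extend, hw.2]
  simp only [simStep]
  split_ifs <;> rfl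

variable [Fintype R] [Fintype Γ] [DecidableEq R] [DecidableEq Γ]
variable (N : M.SuccessorNaming) (filler : Fin n → SimState R Γ → SimAction n R Γ)
  (σ : Strategy (GState n R Γ) (Act n R Γ .last)) (k : ℕ)

theorem value_info_some {t : R × Γ × Dir}
    (ht : ATM.applyTrans c t = some c') :
    value M N filler σ (k + 1) (extend w (afterSim (infoOf c.head t))) =
      value M N filler σ k (extend (extend w (.announce c.head t.2.1 t.2.2 t.1))
        (headState M c'.head c'.state)) := by
  obtain ⟨i, hi, rfl⟩ := Option.map_eq_some_iff.mp ht
  rw [value_announce M N filler σ k (i := c.head) (g := t.2.1) (d := t.2.2) (r := t.1)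
    (by simp [infoOf, afterSim])]
  simp [infoOf, afterSim, afterAnnounce, hi]

theorem value_info_none {t : R × Γ × Dir} (ht : ATM.applyTrans c t = none) :
    value M N filler σ (k + 1) (extend w (afterSim (infoOf c.head t))) = 0 := by
  have hi := Option.map_eq_none_iff.mp ht
  rw [value_announce M N filler σ k (i := c.head) (g := t.2.1) (d := t.2.2) (r := t.1)
    (by simp [infoOf, afterSim])]
  exact value_sink _ _ _ _ _ (by simp [afterAnnounce, hi])

section

variable (hw : Encodes M w c)
include hw

theorem Encodes.value_zero : value M N filler σ 0 w = 0 :=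
  Reduction.value_zero _ _ _ _ (by simp [hw.1, headState])

theorem Encodes.value_head (h : M.κ c.state ≠ .exist) :
    value M N filler σ (k + 1) w =
      ∑ a, simOut M N (filler c.head) c.head (c.tape c.head, some c.state, none) a *
        value M N filler σ k (extend w (afterSim a)) := by
  rw [value_sim M N filler σ k (i := c.head) (hw.1.trans (by simp [headState, h])) (.inl rfl),
    hw.2, if_pos rfl]

theorem Encodes.value_accept (h : M.κ c.state = .accept) : value M N filler σ (k + 1) w = 1 := by
  rw [hw.value_head N filler σ k (by simp [h])]
  simp only [simOut, h]
  rw [FinDist.sum_point_mul, value_goal]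
  simp [afterSim]

theorem Encodes.value_reject (h : M.κ c.state = .reject) : value M N filler σ (k + 1) w = 0 := by
  rw [hw.value_head N filler σ k (by simp [h])]
  simp only [simOut, h]
  rw [FinDist.sum_point_mul, value_sink]
  simp [afterSim]

theorem Encodes.value_det (h : M.κ c.state = .det) : value M N filler σ (k + 1) w =
    value M N filler σ k
      (extend w (afterSim (infoOf c.head (N.succ .α c.state (c.tape c.head))))) := by
  rw [hw.value_head N filler σ k (by simp [h])]
  simp only [simOut, h]
  rw [FinDist.sum_point_mul]

theorem Encodes.value_univ (h : M.κ c.state = .univ) : value M N filler σ (k + 1) w =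
    (value M N filler σ k
      (extend w (afterSim (infoOf c.head (N.succ .α c.state (c.tape c.head))))) +
    value M N filler σ k
      (extend w (afterSim (infoOf c.head (N.succ .β c.state (c.tape c.head)))))) / 2 := by
  rw [hw.value_head N filler σ k (by simp [h])]
  simp only [simOut, h]
  rw [FinDist.sum_quarters_mul]
  push_cast
  ring

theorem Encodes.value_exist (h : M.κ c.state = .exist) : value M N filler σ (k + 1) w =
    σ m w Branch.α * value M N filler σ k (extend w (.choice c.head .α)) +
    σ m w Branch.β * value M N filler σ k (extend w (.choice c.head .β)) :=
  value_head_exist _ _ _ _ _ (hw.1.trans (by simp [headState, h]))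

theorem Encodes.value_choice (h : M.κ c.state = .exist) (b : Branch) :
    value M N filler σ (k + 1) (extend w (.choice c.head b)) =
      value M N filler σ k (extend (extend w (.choice c.head b))
        (afterSim (infoOf c.head (N.succ b c.state (c.tape c.head))))) := by
  rw [value_sim M N filler σ k (i := c.head) (v := .choice c.head b) (by simp)
    (.inr ⟨_, rfl⟩), simState_extend, hw.2]
  simp only [simStep, if_true, simOut, h]
  rw [FinDist.sum_point_mul]

end

end Reduction

/-! ### The horizon and the simulating strategy -/

namespace Reduction

theorem two_le_card_pow {n : ℕ} [NeZero n] {R Γ : Type} [Fintype R] [Fintype Γ] (M : ATM R Γ) :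
    2 ≤ Fintype.card (Γ × Option R) ^ n := by
  have hΓ : 0 < Fintype.card Γ := Fintype.card_pos_iff.mpr ⟨M.blank⟩
  have hR : 0 < Fintype.card R := Fintype.card_pos_iff.mpr ⟨M.r₀⟩
  have h : 2 ≤ Fintype.card (Γ × Option R) := by
    rw [Fintype.card_prod, Fintype.card_option]
    nlinarith
  exact h.trans (Nat.le_self_pow (NeZero.ne n) _)

variable {n : ℕ} {R Γ : Type} [Fintype R] [Fintype Γ]

theorem strategy_sum (σ : Strategy (GState n R Γ) (Act n R Γ .last)) {m : ℕ}
    (w : Fin (m + 1) → GState n R Γ) : σ m w Branch.α + σ m w Branch.β = 1 :=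
  (sum_branch _).symm.trans (stdSimplex.sum_eq_one (σ m w))

theorem strategy_nonneg (σ : Strategy (GState n R Γ) (Act n R Γ .last)) {m : ℕ}
    (w : Fin (m + 1) → GState n R Γ) (b : Branch) : 0 ≤ σ m w b :=
  (σ m w).2.1 b

variable [NeZero n]

/-- Here `k` is the number of transitions left after the one out of `start`. The last bound allows
three game steps per rank; `2 ≤ k` gives `k + 1 < 2 * k` in `half_pow_lt`. -/
theorem horizon_eq (M : ATM R Γ) : ∃ k, horizon n R Γ = k + 2 ∧ 2 ≤ k ∧
    3 * Nat.card (MachineID n R Γ) ≤ k := by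
  have h₁ := two_le_card_pow (n := n) M
  have h₂ := ATM.card_machineID_lt (n := n) M
  exact ⟨horizon n R Γ - 2, by unfold horizon; omega, by unfold horizon; omega,
    by unfold horizon; omega⟩

theorem half_pow_lt (M : ATM R Γ) : 1 - (1 / 2 : ℝ) ^ (horizon n R Γ - 1)
    < 1 - (1 / 4 : ℝ) ^ (horizon n R Γ - 2) := by
  obtain ⟨k, hk, hk2, -⟩ := horizon_eq (n := n) M
  rw [hk, show k + 2 - 1 = k + 1 from rfl, show k + 2 - 2 = k from rfl,
    show (1 / 4 : ℝ) = (1 / 2) ^ 2 by norm_num, ← pow_mul]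
  exact sub_lt_sub_left (pow_lt_pow_right_of_lt_one₀ (by norm_num) (by norm_num) (by omega)) 1

/-- The strategy that starts the simulation and then follows a choice of successors of existential
IDs. -/
noncomputable def simulate (M : ATM R Γ) (best : MachineID n R Γ → Branch) :
    Strategy (GState n R Γ) (Act n R Γ .last) :=
  fun m w => FinDist.point (X := Branch) <|
    match w (Fin.last m) with
    | .head i _ =>
      -- The ID is read off from the simulators' transducer states, which are functions of the
      -- history.
      match (simState M w i).2.1 with
      | some r => best ⟨fun j => (simState M w j).1, i, r⟩
      | none => .β
    -- This default matters at `start`, where it launches the simulation.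
    | _ => .β

theorem simulate_start {M : ATM R Γ} (best : MachineID n R Γ → Branch) {m : ℕ}
    {w : Fin (m + 1) → GState n R Γ} (hw : w (Fin.last m) = .start) :
    simulate M best m w = FinDist.point (X := Branch) .β := by
  simp only [simulate, hw]
  rfl

theorem Encodes.simulate_eq {M : ATM R Γ} (best : MachineID n R Γ → Branch) {m : ℕ}
    {w : Fin (m + 1) → GState n R Γ} {c : MachineID n R Γ} (hw : Encodes M w c) :
    simulate M best m w = FinDist.point (X := Branch) (best c) := by
  simp only [simulate, hw.1, headState, hw.2, if_true]
  rfl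

/-! ### Bounds on the value of the simulation -/

variable [DecidableEq R] [DecidableEq Γ] {M : ATM R Γ} (N : M.SuccessorNaming)
  (filler : Fin n → SimState R Γ → SimAction n R Γ)

theorem one_sub_half_pow_le {k l : ℕ} (h : k ≤ l) :
    1 - (1 / 2 : ℝ) ^ k ≤ 1 - (1 / 2 : ℝ) ^ l :=
  sub_le_sub_left (pow_le_pow_of_le_one (by norm_num) (by norm_num) h) 1

section

variable (σ : Strategy (GState n R Γ) (Act n R Γ .last))

/-- Common step for all machine transitions: a bad announcement either moves the head off the tape,
giving value 0, or leads to a non-accepting ID covered by the induction hypothesis. -/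
theorem value_info_le {k m : ℕ} {w : Fin (m + 1) → GState n R Γ} {c : MachineID n R Γ}
    (hw : ∀ j, (simState M w j).1 = c.tape j) {t : R × Γ × Dir}
    (ht : ∀ c', ATM.applyTrans c t = some c' → IsEmpty (M.AcceptingTree n c'))
    (ih : ∀ k' < k, ∀ (m : ℕ) (w : Fin (m + 1) → GState n R Γ) (c : MachineID n R Γ),
      Encodes M w c → IsEmpty (M.AcceptingTree n c) →
        value M N filler σ k' w ≤ 1 - (1 / 2 : ℝ) ^ k') :
    value M N filler σ k (extend w (afterSim (infoOf c.head t))) ≤ 1 - (1 / 2 : ℝ) ^ k := by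
  obtain _ | k := k
  · rw [value_zero _ _ _ _ (by simp [infoOf, afterSim])]
    norm_num
  · cases hc' : ATM.applyTrans c t with
    | none =>
      rw [value_info_none N filler σ k hc', sub_nonneg]
      exact pow_le_one₀ (by norm_num) (by norm_num)
    | some c' =>
      rw [value_info_some N filler σ k hc']
      exact (ih k k.lt_succ_self _ _ _ (encodes_extend hw hc') (ht c' hc')).trans
        (one_sub_half_pow_le k.le_succ)

/-- If the machine does not accept from an ID, the last agent fails to reach its goal within `k`
steps with probability at least `2⁻ᵏ`. -/
theorem Encodes.value_le (k : ℕ) : ∀ (m : ℕ) (w : Fin (m + 1) → GState n R Γ)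
    (c : MachineID n R Γ), Encodes M w c → IsEmpty (M.AcceptingTree n c) →
      value M N filler σ k w ≤ 1 - (1 / 2 : ℝ) ^ k := by
  -- Strong induction, since a machine transition uses two or three game steps.
  induction k using Nat.strong_induction_on with
  | _ k ih =>
    intro m w c hw hc
    obtain _ | k := k
    · rw [hw.value_zero]
      norm_num
    have info := @value_info_le n R Γ _ _ _ _ _ M N filler σ
    cases h : M.κ c.state with
    | accept => exact hc.elim (.leaf c h)
    | reject =>
      rw [hw.value_reject N filler σ k h, sub_nonneg]
      exact pow_le_one₀ (by norm_num) (by norm_num)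
    | det =>
      rw [hw.value_det N filler σ k h]
      refine (info hw.tape_eq (fun c' hc' => ⟨fun T => hc.elim (.choose c (.inr h) _ ?_ c' hc' T)⟩)
        fun k' hk' => ih k' (by omega)).trans (one_sub_half_pow_le k.le_succ)
      exact (N.mem_transAt (.inl h) _).mpr ⟨_, rfl⟩
    | exist =>
      rw [hw.value_exist N filler σ k h]
      -- Both choices obey the same bound, hence so does any mixture of them.
      have key : ∀ b, value M N filler σ k (extend w (.choice c.head b))
          ≤ 1 - (1 / 2 : ℝ) ^ (k + 1) := by
        intro b
        obtain _ | k := k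
        · rw [Reduction.value_zero _ _ _ _ (by simp)]
          norm_num
        rw [hw.value_choice N filler σ k h]
        refine (info (hw.tape_eq_choice b)
          (fun c' hc' => ⟨fun T => hc.elim (.choose c (.inl h) _ ?_ c' hc' T)⟩)
          fun k' hk' => ih k' (by omega)).trans (one_sub_half_pow_le (by omega))
        exact (N.mem_transAt (.inr (.inl h)) _).mpr ⟨_, rfl⟩
      have hsum := strategy_sum σ w
      have hα := mul_le_mul_of_nonneg_left (key .α) (strategy_nonneg σ w .α)
      have hβ := mul_le_mul_of_nonneg_left (key .β) (strategy_nonneg σ w .β)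
      calc _ ≤ (σ m w Branch.α + σ m w Branch.β) * (1 - (1 / 2 : ℝ) ^ (k + 1)) := by linarith
        _ = _ := by rw [hsum, one_mul]
    | univ =>
      rw [hw.value_univ N filler σ k h]
      -- If both named successors stayed in range and accepted, their trees would combine into one
      -- for `c`.
      have hbad : ∃ b, ∀ c',
          ATM.applyTrans c (N.succ b c.state (c.tape c.head)) = some c' →
            IsEmpty (M.AcceptingTree n c') := by
        by_contra! hgood
        choose f hf hT using hgood
        refine hc.elim (.all c h (fun t ht => ?_) fun t ht c' hc' => Classical.choice ?_) <;>
          obtain ⟨b, rfl⟩ := (N.mem_transAt (.inr (.inr h)) _).mp ht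
        · rw [hf]
          rfl
        · obtain rfl : f b = c' := Option.some.inj ((hf b).symm.trans hc')
          exact hT b
      obtain ⟨b, hb⟩ := hbad
      have h₁ := info (k := k) hw.tape_eq hb fun k' hk' => ih k' (by omega)
      have h₂ := fun b => value_le_one M N filler σ k
        (w := extend w (afterSim (infoOf c.head (N.succ b c.state (c.tape c.head)))))
      have hα := h₂ .α
      have hβ := h₂ .β
      -- The bad successor has weight 1/2 and the other value is at most 1, so the failure
      -- probability at most halves.
      rw [pow_succ]
      cases b <;> linarith

end

theorem sum_branch_point (b : Branch) (f : Branch → ℝ) :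
    FinDist.point b .α * f .α + FinDist.point b .β * f .β = f b :=
  (sum_branch fun x => FinDist.point b x * f x).symm.trans (FinDist.sum_point_mul b f)

/-- Under `best` the rank drops at every machine transition, whichever way the coins fall, so
acceptance is certain within the allotted time. -/
theorem Encodes.value_simulate {best : MachineID n R Γ → Branch}
    (hbest : ∀ c, M.κ c.state = .exist → ∀ d, c ∈ M.acceptingWithin (d + 1) →
        ∃ c', ATM.applyTrans c (N.succ (best c) c.state (c.tape c.head)) = some c' ∧
          c' ∈ M.acceptingWithin d) (d : ℕ) {k m : ℕ} {w : Fin (m + 1) → GState n R Γ}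
    {c : MachineID n R Γ} (hw : Encodes M w c) (hc : c ∈ M.acceptingWithin d) (hk : 3 * d ≤ k) :
    value M N filler (simulate M best) k w = 1 := by
  induction d generalizing k m w c with
  | zero => exact absurd hc (Set.notMem_empty c)
  | succ d ih =>
    -- An existential transition uses all three steps (choice, announcement, head move); the others
    -- leave a step to spare.
    obtain ⟨k, rfl⟩ : ∃ l, k = l + 3 := ⟨k - 3, by omega⟩
    cases h : M.κ c.state with
    | accept => exact hw.value_accept N filler _ _ h
    | reject => simp [ATM.acceptingWithin, h] at hc
    | exist =>
      obtain ⟨c', hc', hd⟩ := hbest c h d hc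
      rw [hw.value_exist N filler _ _ h, hw.simulate_eq best]
      refine (sum_branch_point (best c) fun b => value M N filler (simulate M best) (k + 2)
        (extend w (.choice c.head b))).trans ?_
      rw [hw.value_choice N filler _ _ h, value_info_some N filler _ _ hc']
      exact ih (encodes_extend (hw.tape_eq_choice _) hc') hd (by omega)
    | det =>
      obtain h' | ⟨_, t, ht, c', hc', hd⟩ | ⟨h', _⟩ := hc
      · simp [h] at h'
      · obtain rfl := (M.det_unique _ _ h).unique ht
          ((N.mem_transAt (.inl h) _).mpr ⟨.α, rfl⟩)
        rw [hw.value_det N filler _ _ h, value_info_some N filler _ _ hc']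
        exact ih (encodes_extend hw.tape_eq hc') hd (by omega)
      · simp [h] at h'
    | univ =>
      obtain h' | ⟨h', _⟩ | ⟨_, hall⟩ := hc
      · simp [h] at h'
      · simp [h] at h'
      · have key : ∀ b, value M N filler (simulate M best) (k + 2)
            (extend w (afterSim (infoOf c.head (N.succ b c.state (c.tape c.head))))) = 1 := by
          intro b
          obtain ⟨c', hc', hd⟩ := hall _ ((N.mem_transAt (.inr (.inr h)) _).mpr ⟨b, rfl⟩)
          rw [value_info_some N filler _ _ hc']
          exact ih (encodes_extend hw.tape_eq hc') hd (by omega)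
        rw [hw.value_univ N filler _ _ h, key, key]
        norm_num

/-! ### Payoffs from `start` and the equilibrium criterion -/

variable (M) in
theorem value_start_const (σ : Strategy (GState n R Γ) (Act n R Γ .last)) (k : ℕ) :
    value M N filler σ (k + 1) (m := 0) (fun _ => .start) =
      σ 0 (fun _ => .start) Branch.α * (1 - (1 / 4 : ℝ) ^ k) +
      σ 0 (fun _ => .start) Branch.β *
        value M N filler σ k (extend (fun _ : Fin 1 => .start) (headState M 0 M.r₀)) := by
  rw [value_start M N filler σ k rfl, value_base]
  exact Fin.snoc_last (α := fun _ => GState n R Γ) _ _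

theorem payoff_profile : (game M n).payoff (profile M N filler) .last
    = 1 - (1 / 4 : ℝ) ^ (horizon n R Γ - 2) := by
  -- The profile is the trivial deviation, so the recursion for deviations computes its payoff.
  have hdev : deviation M N filler (profile M N filler .last) = profile M N filler :=
    Function.update_eq_self _ _
  rw [← hdev, payoff_deviation]
  obtain ⟨k, hk, -⟩ := horizon_eq (n := n) M
  rw [hk, show k + 2 - 1 = k + 1 from rfl, show k + 2 - 2 = k from rfl, value_start_const]
  exact sum_branch_point .α fun b => match b with
    | .α => 1 - (1 / 4 : ℝ) ^ k
    | .β => value M N filler (profile M N filler .last) k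
        (extend (fun _ : Fin 1 => .start) (headState M 0 M.r₀))

theorem exists_payoff_eq_one (h : M.AcceptsEmptyTape n) :
    ∃ σ : Strategy (GState n R Γ) (Act n R Γ .last),
      (game M n).payoff (deviation M N filler σ) .last = 1 := by
  obtain ⟨T⟩ := h
  obtain ⟨d, hd⟩ := ATM.exists_mem_acceptingWithin N T
  obtain ⟨best, hbest⟩ := ATM.exists_decreasing_choice (n := n) N
  refine ⟨simulate M best, ?_⟩
  obtain ⟨k, hk, -, hcard⟩ := horizon_eq (n := n) M
  rw [payoff_deviation, hk, show k + 2 - 1 = k + 1 from rfl, value_start_const,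
    simulate_start best rfl, encodes_initID.value_simulate N filler hbest _
      (M.mem_acceptingWithin_card hd) hcard]
  exact sum_branch_point .β fun b => match b with
    | .α => 1 - (1 / 4 : ℝ) ^ k
    | .β => 1

/-- Without acceptance, playing `β` first is bounded by the probability of failing to reach the
goal in the simulation. -/
theorem payoff_deviation_le (h : ¬ M.AcceptsEmptyTape n)
    (σ : Strategy (GState n R Γ) (Act n R Γ .last)) :
    (game M n).payoff (deviation M N filler σ) .last ≤
      σ 0 (fun _ => .start) Branch.α * (1 - (1 / 4 : ℝ) ^ (horizon n R Γ - 2)) +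
      σ 0 (fun _ => .start) Branch.β * (1 - (1 / 2 : ℝ) ^ (horizon n R Γ - 1)) := by
  have hT := not_nonempty_iff.mp h
  obtain ⟨k, hk, -⟩ := horizon_eq (n := n) M
  rw [payoff_deviation, hk, show k + 2 - 1 = k + 1 from rfl, show k + 2 - 2 = k from rfl,
    value_start_const]
  gcongr
  · exact strategy_nonneg σ _ _
  -- Only `k` steps remain after `start`, so the exponent `k` would do; it is relaxed to `k + 1`.
  · exact (Encodes.value_le N filler σ k _ _ _ encodes_initID hT).trans
      (one_sub_half_pow_le k.le_succ)

/-- Acceptance allows payoff 1, above the fixed payoff. Otherwise every deviation of the last agent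
is bounded by a mixture of the fixed payoff and a smaller number. -/
theorem isNash_iff :
    (game M n).IsNash (profile M N filler) ↔ ¬ M.AcceptsEmptyTape n := by
  constructor
  · intro hN hacc
    obtain ⟨σ, hσ⟩ := exists_payoff_eq_one N filler hacc
    have hle : (game M n).payoff (deviation M N filler σ) .last
        ≤ (game M n).payoff (profile M N filler) .last := hN .last σ
    rw [hσ, payoff_profile] at hle
    have : (0 : ℝ) < (1 / 4) ^ (horizon n R Γ - 2) := by positivity
    linarith
  · rintro h (i | _) σ
    · rw [payoff_sim, payoff_sim]
    · rw [payoff_profile]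
      refine (payoff_deviation_le N filler h σ).trans ?_
      have hsum := strategy_sum σ (fun _ : Fin 1 => .start)
      have hβ := mul_le_mul_of_nonneg_left (half_pow_lt (n := n) M).le
        (strategy_nonneg σ (fun _ : Fin 1 => .start) .β)
      calc _ ≤ (σ 0 (fun _ => .start) Branch.α + σ 0 (fun _ => .start) Branch.β) *
            (1 - (1 / 4 : ℝ) ^ (horizon n R Γ - 2)) := by linarith
        _ = _ := by rw [hsum, one_mul]

end Reduction

theorem theorem4p3 {R Γ : Type} [Fintype R] [Fintype Γ] [DecidableEq R] [DecidableEq Γ]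
    (M : ATM R Γ) (N : M.SuccessorNaming) (n : ℕ) [NeZero n]
    (filler : Fin n → Reduction.SimState R Γ → Reduction.SimAction n R Γ) :
    -- the profile is a Nash equilibrium iff `M` does not accept within `n` cells
    ((Reduction.game M n).IsNash (Reduction.profile M N filler) ↔ ¬ M.AcceptsEmptyTape n) ∧
    -- the fixed payoff
    (Reduction.game M n).payoff (Reduction.profile M N filler) .last
      = 1 - (1 / 4 : ℝ) ^ (Reduction.horizon n R Γ - 2) ∧
    -- if `M` accepts, the last agent can achieve the payoff `1`
    (M.AcceptsEmptyTape n →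
      ∃ σ : Strategy (Reduction.GState n R Γ) (Reduction.Act n R Γ .last),
        (Reduction.game M n).payoff
          (Function.update (Reduction.profile M N filler) .last σ) .last = 1) ∧
    -- if `M` does not accept, starting the simulation yields less than the fixed payoff
    (¬ M.AcceptsEmptyTape n →
      ∀ σ : Strategy (Reduction.GState n R Γ) (Reduction.Act n R Γ .last),
        σ 0 (fun _ => .start) Branch.β = 1 →
        (Reduction.game M n).payoff
          (Function.update (Reduction.profile M N filler) .last σ) .last
            ≤ 1 - (1 / 2 : ℝ) ^ (Reduction.horizon n R Γ - 1)) ∧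
    1 - (1 / 2 : ℝ) ^ (Reduction.horizon n R Γ - 1)
      < 1 - (1 / 4 : ℝ) ^ (Reduction.horizon n R Γ - 2) := by
  refine ⟨Reduction.isNash_iff N filler, Reduction.payoff_profile N filler,
    Reduction.exists_payoff_eq_one N filler, fun h σ hσ => ?_, Reduction.half_pow_lt M⟩
  have hle := Reduction.payoff_deviation_le N filler h σ
  have hsum := Reduction.strategy_sum σ (fun _ : Fin 1 => .start)
  have hα : σ 0 (fun _ => .start) Branch.α = 0 := by linarith
  rwa [hσ, hα, zero_mul, zero_add, one_mul] at hle
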